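/- Let $\mathcal M=\langle\mathbb R,<,\dots\rangle$ be a first-order structure on $\mathbb R$ over a countable language whose symbols are numbered (so that terms and formulas have Gödel numbers), and assume that its theory is decidable. "Definable" means definable in $\mathcal M$ without parameters. A *stochastic hybrid system* (SHS) $\mathcal H$ with $n$ real variables consists of: a finite set $L$ of locations; a finite set $E$ of edges $e=(\ell,a,\ell')$ labelled by events from a finite alphabet; for each $\ell\in L$ a measurable flow $\gamma_\ell:\mathbb R^n\times\mathbb R^+\to\mathbb R^n$ and an invariant $I(\ell)\subseteq\mathbb R^n$; for each $e\in E$ a guard $G(e)\subseteq\mathbb R^n$ and resets $R_e(v)\subseteq\mathbb R^n$ ($v\in\mathbb R^n$); and, measurably in their parameters, probability distributions $\delta_s$ on $\mathbb R^+$ and $p_s$ on $E$ for each state $s\in S=L\times\mathbb R^n$, and $\eta_e(v)$ on $\mathbb R^n$ for $e\in E$, $v\in\mathbb R^n$. For $s=(\ell,v)$ write $s+\tau=(\ell,\gamma_\ell(v,\tau))$; an edge $e$ is enabled at $s$ if it leaves $\ell$ and $v\in G(e)$. It is required that, for every $s=(\ell,v)\in S$, $\delta_s$-almost every $\tau$ is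 such that $\gamma_\ell(v,\tau')\in I(\ell)$ for all $0\le\tau'\le\tau$ and some edge is enabled at $s+\tau$; that $p_s$ only charges edges enabled at $s$ whenever there are any; and that $\eta_e(v)$ is concentrated on $R_e(v)$ for $v\in G(e)$. The SHS induces a Markov chain on $S$ with kernel $$\kappa(s,B)=\sum_{e=(\ell,a,\ell')\in E}\int_{\mathbb R^+}p_{s+\tau}(e)\int_{\mathbb R^n}\mathbf 1_B(\ell',v')\,d\eta_e(\gamma_\ell(v,\tau))(v')\,d\delta_s(\tau),\qquad s=(\ell,v).$$ $\mathbb P_\mu$ is its law on runs $s_0s_1s_2\dots$ with initial distribution $\mu$, $\mathrm F\,B$ is the event that some $s_i$ is in $B$, and $\mathrm{Pre}(B)=\{s\in S\mid\kappa(s,B)>0\}$. An edge $e$ is *strongly reset* if $\eta_e(v)$ is the same distribution for all $v\in G(e)$; $\mathcal H$ is *cycle-reset* if every cycle of edges contains a strongly reset edge. A set $B\subseteq S$ is definable if $\{v\mid(\ell,v)\in B\}$ is definable for each $\ell\in L$. **Proposition.** There are algorithms, depending only on $\mathcal M$, that do the following. Let $\mathcal H$ be a cycle-reset SHS such that * (H1)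 $\mathcal H$ is defined in $\mathcal M$: all flows, invariants, guards and reset relations $\{(v,v')\mid v'\in R_e(v)\}$ are definable; * (H3) for every $\ell\in L$ and every measurable definable $D\subseteq\mathbb R^n$ the set $\mathrm{Pre}(\{\ell\}\times D)$ is definable, effectively: a program computes, from $\ell$ and a formula for $D$, formulas for $\mathrm{Pre}(\{\ell\}\times D)$ (one for each location); let $\mu$ be a probability distribution on $S$ for which a program decides, from $\ell\in L$ and a formula for a measurable definable set $D\subseteq\mathbb R^n$, whether $\mu(\{\ell\}\times D)>0$; and let $B\subseteq S$ be a measurable definable set. Given $n$, the number of locations, these two programs and formulas defining $B$, the algorithms halt and tell, respectively, whether $\mathbb P_\mu(\mathrm F\,B)=1$ and whether $\mathbb P_\mu(\mathrm F\,B)=0$. -/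

import Mathlib

open MeasureTheory ProbabilityTheory
open scoped NNReal ENNReal

universe u v

/-! ### Gödel numbers of first-order formulas

Formulas with free variables among `x₀, …, x₍ₙ₋₁₎` are the elements of
`𝓛.BoundedFormula Empty n`; sentences are the case `n = 0`. -/

section Coding

variable {𝓛 : FirstOrder.Language.{u, v}}

/-- Gödel number of a term in the variables `x₀, …, x₍ₙ₋₁₎`, relative to a numbering of the
function symbols. -/
def FirstOrder.Language.Term.godelNumber [Encodable (Σ k, 𝓛.Functions k)] {n : ℕ} :
    𝓛.Term (Empty ⊕ Fin n) → ℕ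
  | .var (.inl x) => x.elim
  | .var (.inr i) => Nat.pair 0 i
  | @FirstOrder.Language.Term.func _ _ l f ts =>
      Nat.pair 1 (Nat.pair (Encodable.encode (⟨l, f⟩ : Σ k, 𝓛.Functions k))
        (Encodable.encode (List.ofFn fun i => (ts i).godelNumber)))

/-- Gödel number of a formula in the free variables `x₀, …, x₍ₙ₋₁₎` (`n` itself is not recorded in
the number; a quantifier in front of it binds the variable with the largest index). -/
def FirstOrder.Language.BoundedFormula.godelNumber [Encodable (Σ k, 𝓛.Functions k)]
    [Encodable (Σ k, 𝓛.Relations k)] : {n : ℕ} → 𝓛.BoundedFormula Empty n → ℕ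
  | _, .falsum => Nat.pair 0 0
  | _, .equal t₁ t₂ => Nat.pair 1 (Nat.pair t₁.godelNumber t₂.godelNumber)
  | _, @FirstOrder.Language.BoundedFormula.rel _ _ _ l R ts =>
      Nat.pair 2 (Nat.pair (Encodable.encode (⟨l, R⟩ : Σ k, 𝓛.Relations k))
        (Encodable.encode (List.ofFn fun i => (ts i).godelNumber)))
  | _, .imp φ ψ => Nat.pair 3 (Nat.pair φ.godelNumber ψ.godelNumber)
  | _, .all φ => Nat.pair 4 φ.godelNumber

/-- The subset of `ℝⁿ` defined (without parameters) by a formula in the structure on `ℝ`. -/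
def FirstOrder.Language.BoundedFormula.definedSet [𝓛.Structure ℝ] {n : ℕ}
    (φ : 𝓛.BoundedFormula Empty n) : Set (Fin n → ℝ) :=
  {x | φ.Realize Empty.elim x}

variable (𝓛) in
/-- The first-order theory of the structure on `ℝ` is decidable: some algorithm tells, given the
Gödel number of a sentence, whether the sentence is true. -/
def TheoryOfRealDecidable [Encodable (Σ k, 𝓛.Functions k)] [Encodable (Σ k, 𝓛.Relations k)]
    [𝓛.Structure ℝ] : Prop :=
  ∃ f : ℕ → Bool, Computable f ∧
    ∀ φ : 𝓛.BoundedFormula Empty 0, f φ.godelNumber = true ↔ φ.Realize Empty.elim (![] : Fin 0 → ℝ)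

end Coding

/-! ### Stochastic transition systems -/

section STS

variable {S : Type*} [MeasurableSpace S]

/-- The law `ℙ_μ` on the runs `s₀ s₁ s₂ …` of the Markov kernel `κ` with initial distribution
`μ`. -/
noncomputable def runMeasure (κ : Kernel S S) [IsMarkovKernel κ] (μ : Measure S) :
    Measure (ℕ → S) :=
  Kernel.trajMeasure (X := fun _ => S) μ
    (fun n => κ.comap (fun h : (i : Finset.Iic n) → S => h ⟨n, Finset.mem_Iic.2 le_rfl⟩)
      (measurable_pi_apply _))

/-- The event `F B`: the run visits `B` at some time. -/
def eventually (B : Set S) : Set (ℕ → S) := {ρ | ∃ i, ρ i ∈ B}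

/-- The set `Pre B` of states from which `B` is reached in one step with positive probability. -/
def preSet (κ : Kernel S S) (B : Set S) : Set S := {s | 0 < κ s B}

end STS

/-! ### Hybrid systems and stochastic hybrid systems -/

/-- A hybrid system with `n` real variables, finitely many locations, finitely many events, and
edges labelled by events. Flows are arbitrary functions `ℝⁿ × ℝ⁺ → ℝⁿ`: no semigroup law is
required. -/
structure HybridSystem (n : ℕ) where
  numLoc : ℕ
  numEvent : ℕ
  edges : Finset (Fin numLoc × Fin numEvent × Fin numLoc)
  flow : Fin numLoc → (Fin n → ℝ) → ℝ≥0 → (Fin n → ℝ)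
  inv : Fin numLoc → Set (Fin n → ℝ)
  guard : edges → Set (Fin n → ℝ)
  reset : edges → (Fin n → ℝ) → Set (Fin n → ℝ)

namespace HybridSystem

variable {n : ℕ} (H : HybridSystem n)

abbrev Loc : Type := Fin H.numLoc

abbrev Edge : Type := H.edges

/-- States are pairs of a location and a valuation of the variables; the σ-algebra is the product
of the discrete one and the Borel one. -/
abbrev State : Type := Fin H.numLoc × (Fin n → ℝ)

variable {H}

def Edge.src (e : H.Edge) : H.Loc := e.1.1

def Edge.tgt (e : H.Edge) : H.Loc := e.1.2.2

variable (H)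

/-- The state `s + τ` obtained from `s` by letting `τ` time units elapse. -/
def delayed (s : H.State) (τ : ℝ≥0) : H.State := (s.1, H.flow s.1 s.2 τ)

/-- The edge `e` is enabled at the state `s`. -/
def Enabled (e : H.Edge) (s : H.State) : Prop := Edge.src e = s.1 ∧ s.2 ∈ H.guard e

/-- The set `I(s, e)` of delays after which `e` can be taken from `s`, the invariant of the
location of `s` being satisfied until then. -/
def edgeDelays (s : H.State) (e : H.Edge) : Set ℝ≥0 :=
  {τ | (∀ τ' ≤ τ, H.flow s.1 s.2 τ' ∈ H.inv s.1) ∧ H.Enabled e (H.delayed s τ)}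

/-- The set `I(s) = ⋃ₑ I(s, e)`. -/
def delays (s : H.State) : Set ℝ≥0 := ⋃ e, H.edgeDelays s e

/-- The subset `{ℓ} × D` of the state space. -/
def locSet (ℓ : H.Loc) (D : Set (Fin n → ℝ)) : Set H.State := {s | s.1 = ℓ ∧ s.2 ∈ D}

/-- The system is defined in the structure on `ℝ`: all flows (through their graphs), invariants,
guards and reset relations are definable without parameters. -/
structure DefinedIn (𝓛 : FirstOrder.Language.{u, v}) [𝓛.Structure ℝ] : Prop where
  flow : ∀ ℓ : H.Loc, (∅ : Set ℝ).Definable 𝓛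
    {x : Fin n ⊕ Unit ⊕ Fin n → ℝ | ∃ τ : ℝ≥0, (τ : ℝ) = x (.inr (.inl ())) ∧
      H.flow ℓ (fun i => x (.inl i)) τ = fun i => x (.inr (.inr i))}
  inv : ∀ ℓ : H.Loc, (∅ : Set ℝ).Definable 𝓛 (H.inv ℓ)
  guard : ∀ e : H.Edge, (∅ : Set ℝ).Definable 𝓛 (H.guard e)
  reset : ∀ e : H.Edge, (∅ : Set ℝ).Definable 𝓛
    {x : Fin n ⊕ Fin n → ℝ | (fun i => x (.inr i)) ∈ H.reset e (fun i => x (.inl i))}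

end HybridSystem

/-- A stochastic hybrid system: a hybrid system together with a distribution on the delay spent at
each state, a distribution on the edges at each state, and a distribution on the new valuation for
each edge and valuation, all of them depending measurably on their parameters. From every state,
an edge is almost surely enabled after the random delay; the chosen edge is an enabled one; and the
new valuation is almost surely a possible reset. -/
structure StochHybridSystem (n : ℕ) extends HybridSystem n where
  measurable_flow : ∀ ℓ : toHybridSystem.Loc,
    Measurable fun x : (Fin n → ℝ) × ℝ≥0 => flow ℓ x.1 x.2
  delayDist : Kernel toHybridSystem.State ℝ≥0
  edgeDist : Kernel toHybridSystem.State toHybridSystem.Edge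
  resetDist : toHybridSystem.Edge → Kernel (Fin n → ℝ) (Fin n → ℝ)
  markov_delayDist : IsMarkovKernel delayDist
  markov_edgeDist : IsMarkovKernel edgeDist
  markov_resetDist : ∀ e, IsMarkovKernel (resetDist e)
  delayDist_delays : ∀ s, ∀ᵐ τ ∂delayDist s, τ ∈ toHybridSystem.delays s
  edgeDist_enabled : ∀ s, (∃ e, toHybridSystem.Enabled e s) →
    ∀ e, 0 < edgeDist s {e} → toHybridSystem.Enabled e s
  resetDist_reset : ∀ e, ∀ v ∈ guard e, ∀ᵐ v' ∂resetDist e v, v' ∈ reset e v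

namespace StochHybridSystem

open HybridSystem

variable {n : ℕ} (H : StochHybridSystem n)

instance : IsMarkovKernel H.delayDist := H.markov_delayDist
instance : IsMarkovKernel H.edgeDist := H.markov_edgeDist
instance (e : H.Edge) : IsMarkovKernel (H.resetDist e) := H.markov_resetDist e

theorem measurable_delayed :
    Measurable fun x : H.State × ℝ≥0 => H.delayed x.1 x.2 := by
  refine Measurable.prodMk (by fun_prop) ?_
  have h : Measurable fun y : ((Fin n → ℝ) × ℝ≥0) × Fin H.numLoc => H.flow y.2 y.1.1 y.1.2 :=
    measurable_from_prod_countable_left fun ℓ => H.measurable_flow ℓ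
  exact h.comp (g := fun y : ((Fin n → ℝ) × ℝ≥0) × Fin H.numLoc => H.flow y.2 y.1.1 y.1.2)
    (f := fun x : H.State × ℝ≥0 => ((x.1.2, x.2), x.1.1)) (by fun_prop)

/-- All reset distributions together, as a kernel. -/
noncomputable def resetKernel : Kernel (H.State × H.Edge) (Fin n → ℝ) where
  toFun x := H.resetDist x.2 x.1.2
  measurable' := measurable_from_prod_countable_left fun e =>
    (H.resetDist e).measurable.comp measurable_snd

instance : IsMarkovKernel H.resetKernel :=
  ⟨fun x => (H.markov_resetDist x.2).isProbabilityMeasure x.1.2⟩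

theorem measurable_tgt_pair :
    Measurable fun x : H.Edge × (Fin n → ℝ) => ((Edge.tgt x.1, x.2) : H.State) :=
  ((measurable_of_countable (Edge.tgt (H := H.toHybridSystem))).comp measurable_fst).prodMk
    measurable_snd

/-- The random state after the delay. -/
noncomputable def delayStep : Kernel H.State H.State :=
  (Kernel.deterministic id measurable_id ×ₖ H.delayDist).map (fun x => H.delayed x.1 x.2)

/-- The random state after the discrete step: an edge `e` and then a new valuation are drawn. -/
noncomputable def edgeStep : Kernel H.State H.State :=
  (H.edgeDist ⊗ₖ H.resetKernel).map (fun x => (Edge.tgt x.1, x.2))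

/-- The transition kernel `κ` of the stochastic transition system of `H`: a delay followed by a
discrete step. The formula for it is `step_apply` below. -/
noncomputable def step : Kernel H.State H.State := H.edgeStep ∘ₖ H.delayStep

instance : IsMarkovKernel H.delayStep := Kernel.IsMarkovKernel.map _ H.measurable_delayed

instance : IsMarkovKernel H.edgeStep := Kernel.IsMarkovKernel.map _ H.measurable_tgt_pair

instance : IsMarkovKernel H.step := by unfold step; infer_instance

theorem step_apply (s : H.State) {B : Set H.State} (hB : MeasurableSet B) :
    H.step s B = ∑ e : H.Edge, if Edge.src e = s.1 then
      ∫⁻ τ, H.edgeDist (H.delayed s τ) {e} *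
        (∫⁻ v', B.indicator 1 (Edge.tgt e, v') ∂H.resetDist e (H.flow s.1 s.2 τ)) ∂H.delayDist s
      else 0 := by
  have h0 : ∀ᵐ τ ∂H.delayDist s, ∀ e : H.Edge, Edge.src e ≠ s.1 →
      H.edgeDist (H.delayed s τ) {e} = 0 := by
    filter_upwards [H.delayDist_delays s] with τ hτ e he
    obtain ⟨e', he'⟩ := Set.mem_iUnion.1 hτ
    by_contra h
    exact he (H.edgeDist_enabled _ ⟨e', he'.2⟩ e (pos_iff_ne_zero.2 h)).1
  have hms : ∀ e : H.Edge, MeasurableSet {v' | ((Edge.tgt e, v') : H.State) ∈ B} := fun e =>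
    measurable_prodMk_left hB
  have h1 : ∀ x : H.State, H.edgeStep x B =
      ∑ e : H.Edge, H.edgeDist x {e} * H.resetDist e x.2 {v' | (Edge.tgt e, v') ∈ B} := by
    intro x
    rw [edgeStep, Kernel.map_apply' _ H.measurable_tgt_pair _ hB,
      Kernel.compProd_apply (H.measurable_tgt_pair hB), lintegral_fintype]
    exact Finset.sum_congr rfl fun e _ => mul_comm _ _
  have h2 : ∀ (e : H.Edge) (x : Fin n → ℝ),
      ∫⁻ v', B.indicator 1 (Edge.tgt e, v') ∂H.resetDist e x =
        H.resetDist e x {v' | ((Edge.tgt e, v') : H.State) ∈ B} := by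
    intro e x
    rw [← lintegral_indicator_one (hms e)]
    rfl
  have hd : Measurable (H.delayed s) :=
    H.measurable_delayed.comp (measurable_const.prodMk measurable_id)
  have hm : ∀ e : H.Edge, Measurable fun x : H.State =>
      H.edgeDist x {e} * H.resetDist e x.2 {v' | (Edge.tgt e, v') ∈ B} := fun e =>
    (Kernel.measurable_coe _ (measurableSet_singleton e)).mul
      ((Kernel.measurable_coe _ (hms e)).comp measurable_snd)
  rw [step, Kernel.comp_apply' _ _ _ hB, delayStep,
    Kernel.map_apply _ H.measurable_delayed, Kernel.prod_apply, Kernel.deterministic_apply,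
    lintegral_map (Kernel.measurable_coe _ hB) H.measurable_delayed, Measure.dirac_prod,
    lintegral_map (f := fun a : H.State × ℝ≥0 => H.edgeStep (H.delayed a.1 a.2) B)
      ((Kernel.measurable_coe _ hB).comp H.measurable_delayed) measurable_prodMk_left]
  simp only [h1, h2, id]
  refine (lintegral_finsetSum _ fun e _ => (hm e).comp hd).trans
    (Finset.sum_congr rfl fun e _ => ?_)
  split_ifs with he
  · rfl
  · rw [lintegral_eq_zero_iff ((hm e).comp hd)]
    filter_upwards [h0] with τ hτ
    simp [hτ e he]

/-- The edge `e` is strongly reset: the distribution of the new valuation is the same for all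
valuations at which `e` can be taken. -/
def StronglyReset (e : H.Edge) : Prop :=
  ∃ η : Measure (Fin n → ℝ), ∀ v ∈ H.guard e, H.resetDist e v = η

/-- Every cycle `e₀ e₁ … eₖ` of edges contains a strongly reset edge. -/
def CycleReset : Prop :=
  ∀ (k : ℕ) (c : ℕ → H.Edge), (∀ i < k, Edge.tgt (c i) = Edge.src (c (i + 1))) →
    Edge.tgt (c k) = Edge.src (c 0) → ∃ i ≤ k, H.StronglyReset (c i)

/-- The probability `ℙ_μ(F B)`. -/
noncomputable def reachProb (μ : Measure H.State) (B : Set H.State) : ℝ≥0∞ :=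
  runMeasure H.step μ (eventually B)

variable (𝓛 : FirstOrder.Language.{u, v}) [Encodable (Σ k, 𝓛.Functions k)]
  [Encodable (Σ k, 𝓛.Relations k)] [𝓛.Structure ℝ]

/-- The program `c` effectively witnesses that `Pre({ℓ'} × D)` is definable for every location
`ℓ'` and every (measurable) definable `D`: from locations `ℓ`, `ℓ'` and a formula for `D` it
computes a formula for the part of `Pre({ℓ'} × D)` in location `ℓ`. -/
def ComputesPre (c : Nat.Partrec.Code) : Prop :=
  ∀ (ℓ ℓ' : H.Loc) (φ : 𝓛.BoundedFormula Empty n), MeasurableSet φ.definedSet →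
    ∃ ψ : 𝓛.BoundedFormula Empty n,
      c.eval (Nat.pair ℓ (Nat.pair ℓ' φ.godelNumber)) = Part.some ψ.godelNumber ∧
      ∀ v, v ∈ ψ.definedSet ↔ ((ℓ, v) : H.State) ∈ preSet H.step (H.locSet ℓ' φ.definedSet)

/-- The program `c` decides, from a location `ℓ` and a formula for a (measurable) set `D`, whether
`μ({ℓ} × D) > 0`, with output `1` for yes and `0` for no. -/
def DecidesPositivity (μ : Measure H.State) (c : Nat.Partrec.Code) : Prop :=
  ∀ (ℓ : H.Loc) (φ : 𝓛.BoundedFormula Empty n), MeasurableSet φ.definedSet →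
    ∃ b : Bool, c.eval (Nat.pair ℓ φ.godelNumber) = Part.some b.toNat ∧
      (b = true ↔ 0 < μ (H.locSet ℓ φ.definedSet))

variable {𝓛}

/-- The definable set of states given by one formula per location. -/
def definedStates (φ : H.Loc → 𝓛.BoundedFormula Empty n) : Set H.State :=
  {s | s.2 ∈ (φ s.1).definedSet}

end StochHybridSystem

/-! ### Runs that stay in a set -/

section Staying

variable {S : Type*} [MeasurableSpace S] {κ : Kernel S S}

/-! Let `C` be the set of states from which `B` is reached with positive probability, and `D` the
set of states from which `Cᶜ` is reached with positive probability through `Bᶜ`; both are instances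
of `reachSet`. Then `F B` has probability `0` iff `μ C = 0`. It has probability `1` iff `μ D = 0`:
from `D` a run may enter `Cᶜ` before `B` and then almost surely misses `B`; from outside `D` it
almost surely remains in `C` until it meets `B`, and by decisiveness it cannot stay in `Bᶜ ∩ C`
forever.

Cycle-resetness enters twice, each time by well-founded induction on locations along the edges that
are not strongly reset (`CycleReset.wellFounded`). In `CycleReset.decisive`, the probability of
staying `k` steps in `Bᶜ ∩ C` drops below `1` at every state, so its average against any one law
does too; a strongly reset edge has only one law, and the induction spreads a uniform bound `c < 1`,
whence geometric decay. In `CycleReset.exists_reachStage_succ_subset`, membership in `Pre A` is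
governed by which resets charge `A`; for a strongly reset edge this changes at most once along the
increasing stages, so they stabilise after finitely many steps.

Formulas for `C` and `D` are therefore computable: each stage is obtained from the program for
`Pre`, stabilisation is a sentence settled by the decision procedure of the theory, and the program
for `μ` tests nullity. -/

theorem lintegral_eq_one_iff {ν : Measure S} [IsProbabilityMeasure ν] {f : S → ℝ≥0∞}
    (hle : ∀ s, f s ≤ 1) : ∫⁻ s, f s ∂ν = 1 ↔ ν {s | f s < 1} = 0 := by
  have hset : {s | f s < 1} = {s | ¬ f s = 1} := by
    ext s
    rw [Set.mem_ofPred_eq, Set.mem_ofPred_eq, lt_iff_le_and_ne]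
    exact and_iff_right (hle s)
  rw [hset, ← ae_iff]
  constructor
  · intro h
    exact ae_eq_of_ae_le_of_lintegral_le (g := fun _ => 1) (ae_of_all _ hle)
      (by simp [h]) aemeasurable_const (by simp [h])
  · intro h
    rw [lintegral_congr_ae h]
    simp

/-- The probability, as a function of the initial state, that the first `k` states of a run are
all in `Z`. -/
noncomputable def stayProb (κ : Kernel S S) (Z : Set S) : ℕ → S → ℝ≥0∞
  | 0 => fun _ => 1
  | k + 1 => Z.indicator fun s => ∫⁻ s', stayProb κ Z k s' ∂κ s

theorem measurable_stayProb {Z : Set S} (hZ : MeasurableSet Z) (k : ℕ) :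
    Measurable (stayProb κ Z k) := by
  induction k with
  | zero => exact measurable_const
  | succ k ih => exact ih.lintegral_kernel.indicator hZ

theorem stayProb_succ_le (Z : Set S) (k : ℕ) (s : S) :
    stayProb κ Z (k + 1) s ≤ ∫⁻ s', stayProb κ Z k s' ∂κ s :=
  Set.indicator_le_self' (fun _ _ => zero_le) s

theorem stayProb_of_notMem {Z : Set S} {s : S} (hs : s ∉ Z) (k : ℕ) :
    stayProb κ Z (k + 1) s = 0 :=
  Set.indicator_of_notMem hs _

theorem stayProb_of_mem {Z : Set S} {s : S} (hs : s ∈ Z) (k : ℕ) :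
    stayProb κ Z (k + 1) s = ∫⁻ s', stayProb κ Z k s' ∂κ s :=
  Set.indicator_of_mem hs _

theorem stayProb_mono {Z Z' : Set S} (h : Z ⊆ Z') (k : ℕ) :
    stayProb κ Z k ≤ stayProb κ Z' k := by
  induction k with
  | zero => exact le_rfl
  | succ k ih =>
    intro s
    by_cases hs : s ∈ Z
    · rw [stayProb_of_mem hs, stayProb_of_mem (h hs)]
      exact lintegral_mono ih
    · rw [stayProb_of_notMem hs]
      exact zero_le

/-- Markov property: wherever the run is after `k` steps, staying `m` further steps costs a factor
at most `c`. -/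
theorem stayProb_add_le {Z : Set S} {c : ℝ≥0∞} {m : ℕ} (hc : c ≠ ∞)
    (h : ∀ s, stayProb κ Z m s ≤ c) (k : ℕ) (s : S) :
    stayProb κ Z (k + m) s ≤ c * stayProb κ Z k s := by
  induction k generalizing s with
  | zero => simpa [stayProb] using h s
  | succ k ih =>
    rw [Nat.add_right_comm]
    by_cases hs : s ∈ Z
    · rw [stayProb_of_mem hs, stayProb_of_mem hs, ← lintegral_const_mul' _ _ hc]
      exact lintegral_mono ih
    · simp [stayProb_of_notMem hs]

/-- If a run leaves `Z` within `m` steps with a probability that is bounded away from `0`, then it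
leaves `Z` almost surely. -/
theorem iInf_stayProb_eq_zero {Z : Set S} {c : ℝ≥0∞} {m : ℕ} (hc : c < 1)
    (h : ∀ s, stayProb κ Z m s ≤ c) (s : S) : ⨅ k, stayProb κ Z k s = 0 := by
  have hpow : ∀ j : ℕ, stayProb κ Z (j * m) s ≤ c ^ j := by
    intro j
    induction j with
    | zero => simp [stayProb]
    | succ j ih =>
      rw [Nat.succ_mul, pow_succ']
      exact (stayProb_add_le hc.ne_top h _ s).trans (mul_le_mul_right ih c)
  refine le_antisymm (ge_of_tendsto' (ENNReal.tendsto_pow_atTop_nhds_zero_of_lt_one hc) ?_)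
    zero_le
  exact fun j => (iInf_le _ (j * m)).trans (hpow j)


variable [IsMarkovKernel κ]

theorem stayProb_antitone (Z : Set S) : Antitone (stayProb κ Z) := by
  refine antitone_nat_of_succ_le fun k => ?_
  induction k with
  | zero =>
    intro s
    refine (stayProb_succ_le Z 0 s).trans ?_
    simp [stayProb]
  | succ k ih =>
    intro s
    by_cases hs : s ∈ Z
    · rw [stayProb_of_mem hs, stayProb_of_mem hs]
      exact lintegral_mono ih
    · rw [stayProb_of_notMem hs]
      exact zero_le

theorem stayProb_le_one (Z : Set S) (k : ℕ) (s : S) : stayProb κ Z k s ≤ 1 :=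
  stayProb_antitone Z (Nat.zero_le k) s

/-! ### The law of the runs in terms of staying probabilities. -/

section RunMeasure

variable {μ : Measure S}

instance [IsProbabilityMeasure μ] : IsProbabilityMeasure (runMeasure κ μ) := by
  unfold runMeasure
  infer_instance

theorem map_zero_runMeasure : (runMeasure κ μ).map (fun ρ => ρ 0) = μ := by
  have h : (fun ρ : ℕ → S => ρ 0) = (fun h : (i : Finset.Iic 0) → S => h ⟨0, by simp⟩) ∘
      Preorder.frestrictLe (π := fun _ => S) 0 := rfl
  rw [h, ← Measure.map_map (measurable_pi_apply _) (by fun_prop), runMeasure,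
    Kernel.trajMeasure, Measure.map_comp _ _ (by fun_prop), Kernel.traj_map_frestrictLe,
    Kernel.partialTraj_self, Measure.id_comp, Measure.map_map (by fun_prop) (by fun_prop)]
  exact Measure.map_id

variable [IsProbabilityMeasure μ]

/-- The joint law of the history up to time `m` and the next state is the law of the history
composed with `κ`. -/
theorem setLIntegral_runMeasure_succ {Z : Set S} (hZ : MeasurableSet Z) {g : S → ℝ≥0∞}
    (hg : Measurable g) (m : ℕ) :
    ∫⁻ ρ in {ρ | ∀ i ≤ m, ρ i ∈ Z}, g (ρ (m + 1)) ∂runMeasure κ μ =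
      ∫⁻ ρ in {ρ | ∀ i ≤ m, ρ i ∈ Z}, ∫⁻ s, g s ∂κ (ρ m) ∂runMeasure κ μ := by
  set A : Set ((i : Finset.Iic m) → S) := {h | ∀ i, h i ∈ Z} with hA
  have hAm : MeasurableSet A := by
    rw [hA, Set.ofPred_forall]
    exact MeasurableSet.iInter fun i => measurable_pi_apply i hZ
  have hpre : {ρ : ℕ → S | ∀ i ≤ m, ρ i ∈ Z} =
      Preorder.frestrictLe (π := fun _ => S) m ⁻¹' A := by
    ext ρ
    simp [hA, Preorder.frestrictLe, Finset.restrict]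
  have hg2 : Measurable fun x : ((i : Finset.Iic m) → S) × S => g x.2 := hg.comp measurable_snd
  have key := Kernel.map_frestrictLe_trajMeasure_compProd_eq_map_trajMeasure (X := fun _ => S)
    (μ₀ := μ) (κ := fun n => κ.comap (fun h : (i : Finset.Iic n) → S =>
      h ⟨n, Finset.mem_Iic.2 le_rfl⟩) (measurable_pi_apply _)) (a := m)
  have h1 : ∫⁻ ρ in {ρ | ∀ i ≤ m, ρ i ∈ Z}, g (ρ (m + 1)) ∂runMeasure κ μ =
      ∫⁻ x in A ×ˢ Set.univ, g x.2 ∂(runMeasure κ μ).map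
        (fun ρ => (Preorder.frestrictLe (π := fun _ => S) m ρ, ρ (m + 1))) := by
    rw [setLIntegral_map (hAm.prod MeasurableSet.univ) hg2 (by fun_prop),
      hpre]
    congr 2
    ext ρ
    simp
  rw [h1, runMeasure, ← key, Measure.setLIntegral_compProd hg2 hAm
    MeasurableSet.univ, setLIntegral_map hAm _ (by fun_prop), hpre]
  · simp [Kernel.comap_apply, Preorder.frestrictLe, Finset.restrict]
  · simp only [Measure.restrict_univ]
    exact hg.lintegral_kernel

/-- `m` stays free because each induction step on `k` moves one visit to `Z` from the integrand into
the event. -/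
theorem setLIntegral_stayProb {Z : Set S} (hZ : MeasurableSet Z) (k m : ℕ) :
    ∫⁻ ρ in {ρ | ∀ i < m, ρ i ∈ Z}, stayProb κ Z k (ρ m) ∂runMeasure κ μ =
      runMeasure κ μ {ρ | ∀ i < m + k, ρ i ∈ Z} := by
  induction k generalizing m with
  | zero => simp [stayProb]
  | succ k ih =>
    have hE : {ρ : ℕ → S | ∀ i < m + 1, ρ i ∈ Z} =
        {ρ | ∀ i < m, ρ i ∈ Z} ∩ {ρ | ρ m ∈ Z} := by
      ext ρ
      simp only [Set.mem_ofPred_eq, Set.mem_inter_iff, Nat.forall_lt_succ_right]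
    have hm : MeasurableSet {ρ : ℕ → S | ρ m ∈ Z} := measurable_pi_apply m hZ
    have h3 := setLIntegral_runMeasure_succ (κ := κ) (μ := μ) hZ
      (measurable_stayProb (κ := κ) hZ k) m
    simp only [← Nat.lt_succ_iff, Nat.succ_eq_add_one] at h3
    rw [← Nat.add_assoc, Nat.add_right_comm, ← ih (m + 1), h3, hE, Set.inter_comm,
      ← Measure.restrict_restrict hm, ← lintegral_indicator hm]
    rfl

theorem runMeasure_stay {Z : Set S} (hZ : MeasurableSet Z) (k : ℕ) :
    runMeasure κ μ {ρ | ∀ i < k, ρ i ∈ Z} = ∫⁻ s, stayProb κ Z k s ∂μ := by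
  have h := setLIntegral_stayProb (κ := κ) (μ := μ) hZ k 0
  simp only [Nat.zero_add, Nat.not_lt_zero, false_imp_iff, implies_true, Set.ofPred_true,
    Measure.restrict_univ] at h
  rw [← h, ← lintegral_map (f := stayProb κ Z k) (g := fun ρ : ℕ → S => ρ 0)
    (measurable_stayProb hZ k) (by fun_prop), map_zero_runMeasure]

/-- The complement of the event `F B` is the decreasing intersection of the events that the run
stays outside `B` for `k` steps. -/
theorem runMeasure_compl_eventually {B : Set S} (hB : MeasurableSet B) :
    runMeasure κ μ (eventually B)ᶜ = ∫⁻ s, ⨅ k, stayProb κ Bᶜ k s ∂μ := by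
  have h : (eventually B)ᶜ = ⋂ k, {ρ : ℕ → S | ∀ i < k, ρ i ∈ Bᶜ} := by
    ext ρ
    simp only [eventually, Set.mem_compl_iff, Set.mem_ofPred_eq, not_exists, Set.mem_iInter]
    exact ⟨fun h k i _ => h i, fun h i => h (i + 1) i i.lt_succ_self⟩
  have hm : ∀ k, MeasurableSet {ρ : ℕ → S | ∀ i < k, ρ i ∈ Bᶜ} := fun k => by
    simp only [Set.ofPred_forall]
    exact MeasurableSet.iInter fun i => MeasurableSet.iInter fun _ =>
      measurable_pi_apply i hB.compl
  have ha : Antitone fun k => {ρ : ℕ → S | ∀ i < k, ρ i ∈ Bᶜ} :=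
    fun k l hkl ρ hρ i hi => hρ i (hi.trans_le hkl)
  rw [h, ha.measure_iInter (fun k => (hm k).nullMeasurableSet) ⟨0, measure_ne_top _ _⟩,
    lintegral_iInf (fun k => measurable_stayProb hB.compl k) (stayProb_antitone _)]
  · exact iInf_congr fun k => runMeasure_stay hB.compl k
  · simp [stayProb]

theorem measurableSet_eventually {B : Set S} (hB : MeasurableSet B) :
    MeasurableSet (eventually B) := by
  simp only [eventually, Set.ofPred_exists]
  exact MeasurableSet.iUnion fun i => measurable_pi_apply i hB

theorem runMeasure_eventually_eq_zero_iff {B : Set S} (hB : MeasurableSet B) :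
    runMeasure κ μ (eventually B) = 0 ↔ μ {s | ∃ k, stayProb κ Bᶜ k s < 1} = 0 := by
  rw [← prob_compl_eq_one_iff (measurableSet_eventually hB), runMeasure_compl_eventually hB,
    -- At index `0` the staying probability is `1`, which bounds the infimum.
    lintegral_eq_one_iff fun s => iInf_le_of_le 0 le_rfl]
  simp only [iInf_lt_iff]

theorem runMeasure_eventually_eq_one_iff {B : Set S} (hB : MeasurableSet B) :
    runMeasure κ μ (eventually B) = 1 ↔ μ {s | ⨅ k, stayProb κ Bᶜ k s ≠ 0} = 0 := by
  rw [← prob_compl_eq_zero_iff (measurableSet_eventually hB), runMeasure_compl_eventually hB,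
    lintegral_eq_zero_iff (Measurable.iInf fun k => measurable_stayProb hB.compl k),
    Filter.EventuallyEq, ae_iff]
  rfl

end RunMeasure

end Staying

/-! ### Sets of states from which a set can be reached -/

section Reaching

variable {S : Type*} [MeasurableSpace S]

/-- The `k`-th approximation to the set of states from which `B` can be reached, with positive
probability, through states in `Z`. -/
def reachStage (κ : Kernel S S) (B Z : Set S) : ℕ → Set S
  | 0 => ∅
  | k + 1 => B ∪ Z ∩ preSet κ (reachStage κ B Z k)

/-- The set of states from which `B` can be reached, with positive probability, through states
in `Z`. -/
def reachSet (κ : Kernel S S) (B Z : Set S) : Set S := ⋃ k, reachStage κ B Z k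

variable {κ : Kernel S S} {B Z : Set S}

theorem measurableSet_preSet {A : Set S} (hA : MeasurableSet A) : MeasurableSet (preSet κ A) :=
  measurableSet_lt measurable_const (Kernel.measurable_coe κ hA)

theorem measurableSet_reachStage (hB : MeasurableSet B) (hZ : MeasurableSet Z) (k : ℕ) :
    MeasurableSet (reachStage κ B Z k) := by
  induction k with
  | zero => exact MeasurableSet.empty
  | succ k ih => exact hB.union (hZ.inter (measurableSet_preSet ih))

theorem preSet_mono {A A' : Set S} (h : A ⊆ A') : preSet κ A ⊆ preSet κ A' :=
  fun _ hs => lt_of_lt_of_le hs (measure_mono h)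

theorem preSet_iUnion {ι : Type*} [Countable ι] (A : ι → Set S) :
    preSet κ (⋃ i, A i) = ⋃ i, preSet κ (A i) := by
  ext s
  simp [preSet, pos_iff_ne_zero, measure_iUnion_null_iff]

theorem reachStage_mono : Monotone (reachStage κ B Z) := by
  refine monotone_nat_of_le_succ fun k => ?_
  induction k with
  | zero => exact Set.empty_subset _
  | succ k ih =>
    exact Set.union_subset_union_right _ (Set.inter_subset_inter_right _ (preSet_mono ih))

/-- Each stage is a monotone function of the previous one, so a stage that contains its successor
contains all later stages. This justifies the halting test. -/
theorem reachSet_eq_of_stage_succ_subset {k : ℕ}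
    (h : reachStage κ B Z (k + 1) ⊆ reachStage κ B Z k) : reachSet κ B Z = reachStage κ B Z k := by
  refine subset_antisymm (Set.iUnion_subset fun j => ?_) (Set.subset_iUnion _ k)
  induction j with
  | zero => exact Set.empty_subset _
  | succ j ih =>
    exact (Set.union_subset_union_right _ (Set.inter_subset_inter_right _ (preSet_mono ih))).trans h

/-- The union of the stages is a fixed point because `Pre` commutes with countable unions. -/
theorem reachSet_eq : reachSet κ B Z = B ∪ Z ∩ preSet κ (reachSet κ B Z) := by
  refine subset_antisymm (Set.iUnion_subset fun k => ?_) ?_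
  · cases k with
    | zero => exact Set.empty_subset _
    | succ k =>
      exact Set.union_subset_union_right _ (Set.inter_subset_inter_right _
        (preSet_mono (Set.subset_iUnion _ k)))
  · refine Set.union_subset
      (Set.subset_union_left.trans (Set.subset_iUnion (reachStage κ B Z) 1)) ?_
    rw [reachSet, preSet_iUnion, Set.inter_iUnion]
    exact Set.iUnion_subset fun k =>
      Set.subset_union_right.trans (Set.subset_iUnion (reachStage κ B Z) (k + 1))

variable [IsMarkovKernel κ]

theorem lintegral_kernel_lt_one_iff {f : S → ℝ≥0∞} (hle : ∀ s, f s ≤ 1) (s : S) :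
    ∫⁻ s', f s' ∂κ s < 1 ↔ s ∈ preSet κ {s' | f s' < 1} := by
  have h : ∫⁻ s', f s' ∂κ s ≤ 1 := (lintegral_mono hle).trans (by simp)
  rw [lt_iff_le_and_ne, and_iff_right h, Ne, lintegral_eq_one_iff hle, preSet,
    Set.mem_ofPred_eq, pos_iff_ne_zero]

/-- An average of values at most `1` is below `1` iff values below `1` have positive mass. Starting
the stages at `∅` matches `stayProb κ Bᶜ 0 = 1`. -/
theorem reachStage_eq_setOf_stayProb_lt (k : ℕ) :
    reachStage κ B Bᶜ k = {s | stayProb κ Bᶜ k s < 1} := by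
  induction k with
  | zero => simp [reachStage, stayProb]
  | succ k ih =>
    ext s
    by_cases hs : s ∈ B
    · simp [reachStage, hs, stayProb]
    · rw [Set.mem_ofPred_eq, stayProb_of_mem (Set.mem_compl hs),
        lintegral_kernel_lt_one_iff (stayProb_le_one _ _), ← ih]
      simp [reachStage, hs]

theorem reachSet_eq_setOf_stayProb_lt :
    reachSet κ B Bᶜ = {s | ∃ k, stayProb κ Bᶜ k s < 1} := by
  simp only [reachSet, reachStage_eq_setOf_stayProb_lt, Set.ofPred_exists]

/-- Outside `reachSet κ B Bᶜ` every staying probability is `1`; a positive chance of moving to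
states with positive infimum keeps the infimum positive. Decisiveness is not needed. -/
theorem iInf_stayProb_ne_zero_of_mem_reachStage (hB : MeasurableSet B) {k : ℕ} {s : S}
    (hs : s ∈ reachStage κ (reachSet κ B Bᶜ)ᶜ Bᶜ k) : ⨅ k, stayProb κ Bᶜ k s ≠ 0 := by
  induction k generalizing s with
  | zero => exact hs.elim
  | succ k ih =>
    rcases hs with hs | ⟨hsB, hs⟩
    · rw [reachSet_eq_setOf_stayProb_lt] at hs
      simp only [Set.mem_compl_iff, Set.mem_ofPred_eq, not_exists, not_lt] at hs
      exact (zero_lt_one.trans_le (le_iInf hs)).ne'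
    · have h1 : ∫⁻ s', ⨅ k, stayProb κ Bᶜ k s' ∂κ s ≤ ⨅ k, stayProb κ Bᶜ k s := by
        refine le_iInf fun j => ?_
        refine le_trans ?_ (stayProb_antitone _ (Nat.le_succ j) s)
        rw [stayProb_of_mem hsB]
        exact lintegral_mono fun s' => iInf_le _ j
      refine (lt_of_lt_of_le ?_ h1).ne'
      rw [lintegral_pos_iff_support
        (Measurable.iInf fun k => measurable_stayProb hB.compl k)]
      exact lt_of_lt_of_le hs (measure_mono fun s' hs' => ih hs')

/-- A kernel is decisive for `B` if every run almost surely visits `B` or a state from which `B`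
cannot be reached. -/
def Decisive (κ : Kernel S S) (B : Set S) : Prop :=
  ∀ s, ⨅ k, stayProb κ (Bᶜ ∩ reachSet κ B Bᶜ) k s = 0

/-- From outside the right-hand set, staying in `Bᶜ` is almost surely staying in `Bᶜ ∩ reachSet κ B
Bᶜ`, which decisiveness forbids forever. -/
theorem iInf_stayProb_eq_zero_iff (hB : MeasurableSet B) (hdec : Decisive κ B) (s : S) :
    ⨅ k, stayProb κ Bᶜ k s ≠ 0 ↔ s ∈ reachSet κ (reachSet κ B Bᶜ)ᶜ Bᶜ := by
  refine ⟨fun h => ?_, fun h => ?_⟩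
  · by_contra hs
    refine h (le_antisymm ?_ zero_le)
    rw [← hdec s]
    refine iInf_mono fun k => ?_
    clear h
    induction k generalizing s with
    | zero => exact le_rfl
    | succ k ih =>
      by_cases hsB : s ∈ B
      · rw [stayProb_of_notMem (not_not_intro hsB)]
        exact zero_le
      -- By the fixed-point equation, `s` lies in `reachSet κ B Bᶜ` and its successor is almost
      -- surely outside the right-hand set again.
      · rw [reachSet_eq] at hs
        simp only [Set.mem_union, Set.mem_inter_iff, not_or, Set.mem_compl_iff, not_not, not_and,
          hsB, not_false_eq_true, forall_true_left] at hs
        rw [stayProb_of_mem (Set.mem_compl hsB),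
          stayProb_of_mem (s := s) (Set.mem_inter (Set.mem_compl hsB) hs.1)]
        refine lintegral_mono_ae ?_
        have h0 : κ s (reachSet κ (reachSet κ B Bᶜ)ᶜ Bᶜ) = 0 := by
          by_contra h0
          exact hs.2 (pos_iff_ne_zero.2 h0)
        filter_upwards [measure_eq_zero_iff_ae_notMem.1 h0] with s' hs'
        exact ih s' hs'
  · obtain ⟨k, hk⟩ := Set.mem_iUnion.1 h
    exact iInf_stayProb_ne_zero_of_mem_reachStage hB hk

variable {μ : Measure S} [IsProbabilityMeasure μ]

theorem runMeasure_eventually_eq_zero_iff_reachSet (hB : MeasurableSet B) :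
    runMeasure κ μ (eventually B) = 0 ↔ μ (reachSet κ B Bᶜ) = 0 := by
  rw [runMeasure_eventually_eq_zero_iff hB, reachSet_eq_setOf_stayProb_lt]

theorem runMeasure_eventually_eq_one_iff_reachSet (hB : MeasurableSet B) (hdec : Decisive κ B) :
    runMeasure κ μ (eventually B) = 1 ↔ μ (reachSet κ (reachSet κ B Bᶜ)ᶜ Bᶜ) = 0 := by
  rw [runMeasure_eventually_eq_one_iff hB]
  simp only [iInf_stayProb_eq_zero_iff hB hdec, Set.ofPred_mem_eq]

end Reaching

/-! ### Cycle-reset stochastic hybrid systems -/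

namespace StochHybridSystem

open HybridSystem

variable {n : ℕ} (H : StochHybridSystem n)

theorem measurable_delayed_right (s : H.State) : Measurable (H.delayed s) :=
  H.measurable_delayed.comp (measurable_const.prodMk measurable_id)

theorem lintegral_step (s : H.State) {f : H.State → ℝ≥0∞} (hf : Measurable f) :
    ∫⁻ s', f s' ∂H.step s = ∫⁻ τ, ∑ e : H.Edge, H.edgeDist (H.delayed s τ) {e} *
      ∫⁻ v', f (Edge.tgt e, v') ∂H.resetDist e (H.flow s.1 s.2 τ) ∂H.delayDist s := by
  have h1 : ∀ x : H.State, ∫⁻ s', f s' ∂H.edgeStep x =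
      ∑ e : H.Edge, H.edgeDist x {e} * ∫⁻ v', f (Edge.tgt e, v') ∂H.resetDist e x.2 := by
    intro x
    rw [edgeStep, Kernel.lintegral_map _ H.measurable_tgt_pair _ hf,
      Kernel.lintegral_compProd (f := fun x => f (Edge.tgt x.1, x.2)) _ _ _
        (hf.comp H.measurable_tgt_pair), lintegral_fintype]
    exact Finset.sum_congr rfl fun e _ => mul_comm _ _
  have hm : Measurable fun x : H.State => ∫⁻ s', f s' ∂H.edgeStep x := hf.lintegral_kernel
  rw [step, Kernel.lintegral_comp _ _ _ hf, delayStep,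
    Kernel.lintegral_map _ H.measurable_delayed _ hm,
    Kernel.prod_apply, Kernel.deterministic_apply, Measure.dirac_prod,
    lintegral_map (f := fun a : H.State × ℝ≥0 => ∫⁻ s', f s' ∂H.edgeStep (H.delayed a.1 a.2))
      (hm.comp H.measurable_delayed) measurable_prodMk_left]
  simp only [h1, id]
  rfl

theorem ae_edgeDist_enabled (s : H.State) : ∀ᵐ τ ∂H.delayDist s, ∀ e : H.Edge,
    H.edgeDist (H.delayed s τ) {e} ≠ 0 → Edge.src e = s.1 ∧ H.flow s.1 s.2 τ ∈ H.guard e := by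
  filter_upwards [H.delayDist_delays s] with τ hτ e he
  obtain ⟨e', he'⟩ := Set.mem_iUnion.1 hτ
  exact H.edgeDist_enabled _ ⟨e', he'.2⟩ e (pos_iff_ne_zero.2 he)

variable {H}

theorem step_eq_zero_iff (s : H.State) {A : Set H.State} (hA : MeasurableSet A) :
    H.step s A = 0 ↔ ∀ᵐ τ ∂H.delayDist s, ∀ e : H.Edge, H.edgeDist (H.delayed s τ) {e} ≠ 0 →
      H.resetDist e (H.flow s.1 s.2 τ) {v' | (Edge.tgt e, v') ∈ A} = 0 := by
  have hA' : ∀ e : H.Edge, MeasurableSet {v' | ((Edge.tgt e, v') : H.State) ∈ A} := fun e =>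
    measurable_prodMk_left hA
  have h2 : ∀ (e : H.Edge) (x : Fin n → ℝ),
      ∫⁻ v', A.indicator 1 (Edge.tgt e, v') ∂H.resetDist e x =
        H.resetDist e x {v' | ((Edge.tgt e, v') : H.State) ∈ A} := by
    intro e x
    rw [← lintegral_indicator_one (hA' e)]
    rfl
  have hm : Measurable fun τ => ∑ e : H.Edge, H.edgeDist (H.delayed s τ) {e} *
      H.resetDist e (H.flow s.1 s.2 τ) {v' | (Edge.tgt e, v') ∈ A} :=
    Finset.measurable_sum _ fun e _ =>
      (((Kernel.measurable_coe _ (measurableSet_singleton e)).mul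
        ((Kernel.measurable_coe _ (hA' e)).comp measurable_snd)).comp
          (H.measurable_delayed_right s) :)
  rw [← lintegral_indicator_one hA, H.lintegral_step s (measurable_one.indicator hA)]
  simp only [h2]
  rw [lintegral_eq_zero_iff hm]
  refine Filter.eventually_congr (ae_of_all _ fun τ => ?_)
  simp [or_iff_not_imp_left]

/-- The laws of the delay and of the edge do not involve the target set, so only the null sets of
the resets of edges leaving `s.1` matter. -/
theorem mem_preSet_of_forall_edge {s : H.State} {A A' : Set H.State} (hA : MeasurableSet A)
    (hA' : MeasurableSet A')
    (h : ∀ e : H.Edge, Edge.src e = s.1 → ∀ v ∈ H.guard e,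
      H.resetDist e v {v' | (Edge.tgt e, v') ∈ A'} = 0 →
      H.resetDist e v {v' | (Edge.tgt e, v') ∈ A} = 0) (hs : s ∈ preSet H.step A) :
    s ∈ preSet H.step A' := by
  rw [preSet, Set.mem_ofPred_eq, pos_iff_ne_zero, Ne, step_eq_zero_iff s hA] at hs
  rw [preSet, Set.mem_ofPred_eq, pos_iff_ne_zero, Ne, step_eq_zero_iff s hA']
  refine fun h' => hs ?_
  filter_upwards [h', H.ae_edgeDist_enabled s] with τ h1 h2 e he
  exact h e (h2 e he).1 _ (h2 e he).2 (h1 e he)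

/-- A step averages over edges that are almost surely enabled, with weights of sum `1`. -/
theorem lintegral_step_le {s : H.State} {f : H.State → ℝ≥0∞} (hf : Measurable f) {c : ℝ≥0∞}
    (h : ∀ e : H.Edge, Edge.src e = s.1 → ∀ v ∈ H.guard e,
      ∫⁻ v', f (Edge.tgt e, v') ∂H.resetDist e v ≤ c) : ∫⁻ s', f s' ∂H.step s ≤ c := by
  rw [H.lintegral_step s hf]
  calc _ ≤ ∫⁻ _, c ∂H.delayDist s := by
        refine lintegral_mono_ae ?_
        filter_upwards [H.ae_edgeDist_enabled s] with τ hτ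
        calc _ ≤ ∑ e : H.Edge, H.edgeDist (H.delayed s τ) {e} * c := by
              refine Finset.sum_le_sum fun e _ => ?_
              by_cases he : H.edgeDist (H.delayed s τ) {e} = 0
              · simp [he]
              · exact mul_le_mul_right (h e (hτ e he).1 _ (hτ e he).2) _
          _ = c := by
              rw [← Finset.sum_mul, sum_measure_singleton]
              simp
    _ = c := by simp

/-- Following edges that are not strongly reset is a well-founded relation in a cycle-reset
system. -/
theorem CycleReset.wellFounded (hH : H.CycleReset) :
    WellFounded fun ℓ' ℓ : H.Loc =>
      ∃ e : H.Edge, ¬ H.StronglyReset e ∧ Edge.src e = ℓ ∧ Edge.tgt e = ℓ' := by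
  set R := fun ℓ' ℓ : H.Loc =>
    ∃ e : H.Edge, ¬ H.StronglyReset e ∧ Edge.src e = ℓ ∧ Edge.tgt e = ℓ' with hR
  have hpath : ∀ x y, Relation.TransGen R x y → ∃ (k : ℕ) (c : ℕ → H.Edge),
      (∀ i < k, Edge.tgt (c i) = Edge.src (c (i + 1))) ∧ (∀ i ≤ k, ¬ H.StronglyReset (c i)) ∧
      Edge.src (c 0) = y ∧ Edge.tgt (c k) = x := by
    intro x y hxy
    induction hxy with
    | single h =>
      obtain ⟨e, he, hs, ht⟩ := h
      exact ⟨0, fun _ => e, by simp, fun _ _ => he, hs, ht⟩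
    | tail _ h ih =>
      obtain ⟨e, he, hs, ht⟩ := h
      obtain ⟨k, c, h1, h2, h3, h4⟩ := ih
      -- `R` goes from target to source, so a tail step prepends an edge to the path.
      refine ⟨k + 1, fun i => i.casesOn e c, ?_, ?_, hs, h4⟩
      · intro i hi
        cases i with
        | zero => exact ht.trans h3.symm
        | succ i => exact h1 i (Nat.lt_of_succ_lt_succ hi)
      · intro i hi
        cases i with
        | zero => exact he
        | succ i => exact h2 i (Nat.le_of_succ_le_succ hi)
  have : Std.Irrefl (Relation.TransGen R) := ⟨fun x hx => by
    obtain ⟨k, c, h1, h2, h3, h4⟩ := hpath x x hx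
    obtain ⟨i, hi, hi'⟩ := hH k c h1 (h4.trans h3.symm)
    exact h2 i hi hi'⟩
  exact Subrelation.wf (fun h => Relation.TransGen.single h)
    (Finite.wellFounded_of_trans_of_irrefl (Relation.TransGen R))

/-- Shown location by location: a slice is stable one step after no reset from its location gains
new mass. -/
theorem CycleReset.exists_reachStage_succ_subset (hH : H.CycleReset) {B Z : Set H.State}
    (hB : MeasurableSet B) (hZ : MeasurableSet Z) :
    ∃ k, reachStage H.step B Z (k + 1) ⊆ reachStage H.step B Z k := by
  set X := reachStage H.step B Z with hX
  have hXm : ∀ k, MeasurableSet (X k) := measurableSet_reachStage hB hZ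
  have hmono : ∀ {k l}, k ≤ l → X k ⊆ X l := fun h => reachStage_mono h
  have key : ∀ ℓ : H.Loc, ∀ᶠ k in Filter.atTop, ∀ v, (ℓ, v) ∈ X (k + 1) → (ℓ, v) ∈ X k := by
    intro ℓ
    induction ℓ using hH.wellFounded.induction with
    | _ ℓ ih =>
    have hedge : ∀ᶠ k in Filter.atTop, ∀ e : H.Edge, Edge.src e = ℓ → ∀ v ∈ H.guard e,
        H.resetDist e v {v' | (Edge.tgt e, v') ∈ X k} = 0 →
        H.resetDist e v {v' | (Edge.tgt e, v') ∈ X (k + 1)} = 0 := by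
      refine Filter.eventually_all.2 fun e => ?_
      by_cases hsrc : Edge.src e = ℓ
      swap
      · exact Filter.Eventually.of_forall fun k h => absurd h hsrc
      by_cases he : H.StronglyReset e
      · obtain ⟨η, hη⟩ := he
        -- Either `η` charges some stage, hence all later ones and nullity fails, or it never
        -- charges any.
        by_cases hpos : ∃ k, η {v' | (Edge.tgt e, v') ∈ X k} ≠ 0
        · obtain ⟨N, hN⟩ := hpos
          filter_upwards [Filter.eventually_ge_atTop N] with k hk _ v hv h0
          rw [hη v hv] at h0
          refine absurd (measure_mono_null (fun v' hv' => ?_) h0) hN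
          exact hmono hk hv'
        · push Not at hpos
          exact Filter.Eventually.of_forall fun k _ v hv _ => by rw [hη v hv, hpos]
      · filter_upwards [ih _ ⟨e, he, hsrc, rfl⟩] with k hk _ v _ h0
        exact measure_mono_null (fun v' hv' => hk v' hv') h0
    obtain ⟨N, hN⟩ := Filter.eventually_atTop.1 hedge
    -- Stage `k` is computed from stage `k - 1`, which must already be at least `N`.
    refine Filter.eventually_atTop.2 ⟨N + 1, fun k hk v hv => ?_⟩
    obtain ⟨k, rfl⟩ := Nat.exists_eq_add_of_lt hk
    rcases hv with hv | ⟨hvZ, hv⟩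
    · exact Or.inl hv
    · exact Or.inr ⟨hvZ, mem_preSet_of_forall_edge (hXm _) (hXm _)
        (fun e he v hv h0 => hN _ (Nat.le_add_right _ _) e he v hv h0) hv⟩
  obtain ⟨k, hk⟩ := (Filter.eventually_all.2 key).exists
  exact ⟨k, fun s hs => hk s.1 s.2 hs⟩

/-- The aim is a single `m` and `c < 1` such that every state stays `m` steps with probability at
most `c`. -/
theorem CycleReset.decisive (hH : H.CycleReset) {B : Set H.State} (hB : MeasurableSet B) :
    Decisive H.step B := by
  set C := reachSet H.step B Bᶜ with hC
  set g := stayProb H.step (Bᶜ ∩ C) with hg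
  have hCm : MeasurableSet C :=
    MeasurableSet.iUnion fun k => measurableSet_reachStage hB hB.compl k
  have hgm : ∀ k, Measurable (g k) := measurable_stayProb (hB.compl.inter hCm)
  have hanti : Antitone g := stayProb_antitone _
  have hlt : ∀ s, ∃ k, g k s < 1 := by
    intro s
    by_cases hs : s ∈ C
    · rw [hC, reachSet_eq_setOf_stayProb_lt] at hs
      obtain ⟨k, hk⟩ := hs
      exact ⟨k, (stayProb_mono Set.inter_subset_left k s).trans_lt hk⟩
    · exact ⟨1, by rw [hg, stayProb_of_notMem fun h => hs h.2]; exact zero_lt_one⟩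
  -- If all averages were `1`, each `g k` would be `1` almost everywhere, and the countably many
  -- exceptional null sets would cover the space.
  have hlt_int : ∀ (ν : Measure H.State) [IsProbabilityMeasure ν], ∃ k, ∫⁻ s, g k s ∂ν < 1 := by
    intro ν _
    by_contra! hge
    have h0 : ∀ k, ν {s | g k s < 1} = 0 := fun k =>
      (lintegral_eq_one_iff (stayProb_le_one _ k)).1
        (le_antisymm ((lintegral_mono (stayProb_le_one _ k)).trans (by simp)) (hge k))
    have h1 : ν (⋃ k, {s | g k s < 1}) = 0 := measure_iUnion_null h0
    have hU : ⋃ k, {s | g k s < 1} = Set.univ :=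
      Set.iUnion_eq_univ_iff.2 fun s => (hlt s).imp fun _ h => h
    rw [hU, measure_univ] at h1
    exact one_ne_zero h1
  have key : ∀ ℓ : H.Loc, ∃ c < 1, ∀ᶠ k in Filter.atTop, ∀ v, g k (ℓ, v) ≤ c := by
    intro ℓ
    induction ℓ using hH.wellFounded.induction with
    | _ ℓ ih =>
    have hedge : ∀ e : H.Edge, ∃ c < (1 : ℝ≥0∞), ∀ᶠ k in Filter.atTop, Edge.src e = ℓ →
        ∀ v ∈ H.guard e, ∫⁻ v', g k (Edge.tgt e, v') ∂H.resetDist e v ≤ c := by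
      intro e
      by_cases hsrc : Edge.src e = ℓ
      swap
      · exact ⟨0, zero_lt_one, Filter.Eventually.of_forall fun k h => absurd h hsrc⟩
      by_cases he : H.StronglyReset e
      · obtain ⟨η, hη⟩ := he
        -- A point of the guard is needed to know that the common law is a probability measure.
        rcases (H.guard e).eq_empty_or_nonempty with hempty | ⟨v₀, hv₀⟩
        · exact ⟨0, zero_lt_one, Filter.Eventually.of_forall fun k _ v hv => by
            rw [hempty] at hv
            exact hv.elim⟩
        · have hm : Measurable fun v' : Fin n → ℝ => ((Edge.tgt e, v') : H.State) :=
            measurable_prodMk_left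
          have := Measure.isProbabilityMeasure_map (μ := H.resetDist e v₀) hm.aemeasurable
          obtain ⟨N, hN⟩ := hlt_int ((H.resetDist e v₀).map fun v' => (Edge.tgt e, v'))
          rw [lintegral_map (hgm N) hm] at hN
          refine ⟨_, hN, ?_⟩
          filter_upwards [Filter.eventually_ge_atTop N] with k hk _ v hv
          rw [hη v hv, hη v₀ hv₀]
          exact lintegral_mono fun v' => hanti hk _
      · obtain ⟨c, hc, hk⟩ := ih _ ⟨e, he, hsrc, rfl⟩
        refine ⟨c, hc, ?_⟩
        filter_upwards [hk] with k hk _ v _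
        exact (lintegral_mono fun v' => hk v').trans (by simp)
    choose c hc hk using hedge
    obtain ⟨N, hN⟩ := Filter.eventually_atTop.1 (Filter.eventually_all.2 hk)
    -- A finite supremum of numbers below `1` is below `1`, also when there are no edges; one
    -- further step carries the edge bounds back to `ℓ`.
    refine ⟨Finset.univ.sup c, (Finset.sup_lt_iff (by simp)).2 fun e _ => hc e,
      Filter.eventually_atTop.2 ⟨N + 1, fun k hk v => ?_⟩⟩
    refine (hanti hk (ℓ, v)).trans ((stayProb_succ_le _ N (ℓ, v)).trans ?_)
    exact lintegral_step_le (hgm N) fun e he v hv =>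
      (hN N le_rfl e he v hv).trans (Finset.le_sup (Finset.mem_univ e))
  choose c hc hk using key
  obtain ⟨m, hm⟩ := (Filter.eventually_all.2 hk).exists
  exact iInf_stayProb_eq_zero (c := Finset.univ.sup c) (m := m)
    ((Finset.sup_lt_iff (by simp)).2 fun ℓ _ => hc ℓ)
    fun s => (hm s.1 s.2).trans (Finset.le_sup (Finset.mem_univ s.1))

end StochHybridSystem

/-! ### Tabulating partial recursive functions -/

/-- The list of the first `k` values of a partial function. -/
def Part.tabulate {σ : Type*} (f : ℕ →. σ) : ℕ → Part (List σ)
  | 0 => Part.some []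
  | k + 1 => (Part.tabulate f k).bind fun l => (f k).map fun x => l ++ [x]

theorem Part.ofFn_mem_tabulate {σ : Type*} {f : ℕ →. σ} {k : ℕ} {g : Fin k → σ}
    (h : ∀ i : Fin k, g i ∈ f i) : List.ofFn g ∈ Part.tabulate f k := by
  induction k with
  | zero => simp [Part.tabulate]
  | succ k ih =>
    rw [Part.tabulate, List.ofFn_succ_last]
    exact Part.mem_bind (ih fun i => h i.castSucc) (Part.mem_map _ (h (Fin.last k)))

theorem Partrec.tabulate {α σ : Type*} [Primcodable α] [Primcodable σ] {f : α → ℕ →. σ}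
    {k : α → ℕ} (hf : Partrec₂ f) (hk : Computable k) :
    Partrec fun a => Part.tabulate (f a) (k a) := by
  have h := Partrec.nat_rec (f := k) (g := fun _ : α => Part.some ([] : List σ))
    (h := fun a p => (f a p.1).map fun x => p.2 ++ [x]) hk (Partrec.const' _)
    (Partrec.map (hf.comp Computable.fst (Computable.fst.comp Computable.snd))
      (Computable.list_append.comp (Computable.snd.comp (Computable.snd.comp Computable.fst))
        (Computable.list_cons.comp Computable.snd (Computable.const []))).to₂).to₂
  refine h.of_eq fun a => ?_
  induction k a with
  | zero => rfl
  | succ m ih => simp only [Part.tabulate, ← ih]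

/-! ### Computing with Gödel numbers -/

namespace GodelNumber

def falsum : ℕ := Nat.pair 0 0

/-- Codes are combined without decoding. The connectives unfold as in `BoundedFormula`, so that
`of_imp`, `of_neg`, `of_sup` and `of_inf` hold by `rfl`. -/
def imp (a b : ℕ) : ℕ := Nat.pair 3 (Nat.pair a b)

def neg (a : ℕ) : ℕ := imp a falsum

def sup (a b : ℕ) : ℕ := imp (neg a) b

def inf (a b : ℕ) : ℕ := neg (imp a (neg b))

def disj (l : List ℕ) : ℕ := l.foldr sup falsum

/-- Gödel number of the universal closure of a formula in `n` variables. -/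
def alls (n a : ℕ) : ℕ := n.rec a fun _ b => Nat.pair 4 b

/-- `BoundedFormula.alls` adds the innermost quantifier first, the recursion of `alls` the outermost
last. -/
theorem alls_pair (n a : ℕ) : alls n (Nat.pair 4 a) = alls (n + 1) a := by
  induction n with
  | zero => rfl
  | succ n ih => exact congrArg (Nat.pair 4) ih

theorem primrec_imp : Primrec₂ imp :=
  Primrec₂.natPair.comp (Primrec.const 3) Primrec₂.natPair

theorem primrec_neg : Primrec neg := primrec_imp.comp Primrec.id (Primrec.const _)

theorem primrec_sup : Primrec₂ sup := primrec_imp.comp (primrec_neg.comp Primrec.fst) Primrec.snd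

theorem primrec_inf : Primrec₂ inf :=
  primrec_neg.comp (primrec_imp.comp Primrec.fst (primrec_neg.comp Primrec.snd))

theorem primrec_disj : Primrec disj :=
  Primrec.list_foldr Primrec.id (Primrec.const _)
    (primrec_sup.comp (Primrec.fst.comp Primrec.snd) (Primrec.snd.comp Primrec.snd)).to₂

theorem primrec_alls : Primrec₂ alls :=
  Primrec.nat_rec' Primrec.fst Primrec.snd
    (Primrec₂.natPair.comp (Primrec.const 4) (Primrec.snd.comp Primrec.snd)).to₂

/-- The entry of a list of Gödel numbers at a location, `⊥` outside the list. -/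
abbrev entry (X : List ℕ) (ℓ : ℕ) : ℕ := X.getD ℓ falsum

theorem primrec_entry : Primrec₂ entry := Primrec.list_getD falsum

/-- Gödel numbers of the notations of the formulas for the first `L` locations. -/
def compl (L : ℕ) (X : List ℕ) : List ℕ := (List.range L).map fun ℓ => neg (entry X ℓ)

theorem primrec_compl : Primrec₂ compl :=
  Primrec.list_map (Primrec.list_range.comp Primrec.fst)
    (primrec_neg.comp (primrec_entry.comp (Primrec.snd.comp Primrec.fst) Primrec.snd)).to₂

/-- Gödel number of the sentence that expresses that, at each of the first `L` locations, the
formula in `X` implies the one in `Y`. -/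
def inclusion (n L : ℕ) (X Y : List ℕ) : ℕ :=
  alls n (neg (disj ((List.range L).map fun ℓ => neg (imp (entry X ℓ) (entry Y ℓ)))))

theorem primrec_inclusion :
    Primrec fun p : (ℕ × ℕ) × List ℕ × List ℕ => inclusion p.1.1 p.1.2 p.2.1 p.2.2 :=
  primrec_alls.comp (Primrec.fst.comp Primrec.fst) <| primrec_neg.comp <| primrec_disj.comp <|
    Primrec.list_map (Primrec.list_range.comp (Primrec.snd.comp Primrec.fst))
      (primrec_neg.comp (primrec_imp.comp
        (primrec_entry.comp (Primrec.fst.comp (Primrec.snd.comp Primrec.fst)) Primrec.snd)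
        (primrec_entry.comp (Primrec.snd.comp (Primrec.snd.comp Primrec.fst)) Primrec.snd))).to₂

variable {𝓛 : FirstOrder.Language.{u, v}} [Encodable (Σ k, 𝓛.Functions k)]
  [Encodable (Σ k, 𝓛.Relations k)] {n : ℕ}

open FirstOrder.Language

theorem of_imp (φ ψ : 𝓛.BoundedFormula Empty n) :
    (φ.imp ψ).godelNumber = imp φ.godelNumber ψ.godelNumber := rfl

theorem of_neg (φ : 𝓛.BoundedFormula Empty n) : φ.not.godelNumber = neg φ.godelNumber := rfl

theorem of_sup (φ ψ : 𝓛.BoundedFormula Empty n) :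
    (φ ⊔ ψ).godelNumber = sup φ.godelNumber ψ.godelNumber := rfl

theorem of_inf (φ ψ : 𝓛.BoundedFormula Empty n) :
    (φ ⊓ ψ).godelNumber = inf φ.godelNumber ψ.godelNumber := rfl

theorem of_disj (l : List (𝓛.BoundedFormula Empty n)) :
    (l.foldr (· ⊔ ·) ⊥).godelNumber = disj (l.map BoundedFormula.godelNumber) := by
  induction l with
  | nil => rfl
  | cons φ l ih => rw [List.foldr_cons, of_sup, ih]; rfl

theorem of_alls (φ : 𝓛.BoundedFormula Empty n) :
    BoundedFormula.godelNumber (n := 0) φ.alls = alls n φ.godelNumber := by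
  induction n with
  | zero => rfl
  | succ n ih => exact (ih φ.all).trans (alls_pair n _)

end GodelNumber

/-! ### The algorithms -/

section Programs

open GodelNumber
open Nat.Partrec (Code)

/-- Gödel number of a formula for the part of `Pre` of the set coded by `X` in location `ℓ`. -/
def preProgram (L : ℕ) (pre : Code) (X : List ℕ) (ℓ : ℕ) : Part ℕ :=
  (Part.tabulate (fun ℓ' => pre.eval (Nat.pair ℓ (Nat.pair ℓ' (entry X ℓ')))) L).map disj

/-- One step of the computation of a reachable set. -/
def stageStep (L : ℕ) (pre : Code) (B Z X : List ℕ) : Part (List ℕ) :=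
  Part.tabulate (fun ℓ => (preProgram L pre X ℓ).map fun a => sup (entry B ℓ) (inf (entry Z ℓ) a)) L

/-- The empty list stands for `∅`, since `entry` defaults to `falsum`. -/
def stageProgram (L : ℕ) (pre : Code) (B Z : List ℕ) (k : ℕ) : Part (List ℕ) :=
  k.rec (Part.some []) fun _ X => X.bind (stageStep L pre B Z)

/-- The computation of the set of states from which `B` can be reached through `Z`. The function
`f` decides the truth of sentences. -/
def reachProgram (f : ℕ → Bool) (n L : ℕ) (pre : Code) (B Z : List ℕ) : Part (List ℕ) :=
  (Nat.rfind fun k => (stageProgram L pre B Z k).bind fun X =>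
    (stageStep L pre B Z X).map fun Y => f (inclusion n L Y X)).bind (stageProgram L pre B Z)

/-- The test whether the set coded by `X` is a null set. -/
def nullProgram (L : ℕ) (pos : Code) (X : List ℕ) : Part Bool :=
  (Part.tabulate (fun ℓ => pos.eval (Nat.pair ℓ (entry X ℓ))) L).map
    fun l => decide (l.foldr (· + ·) 0 = 0)

section Computability

attribute [local irreducible] inclusion

variable {α : Type*} [Primcodable α] {n L k ℓ : α → ℕ} {pre pos : α → Code} {B Z X : α → List ℕ}

theorem computable_inclusion {Y : α → List ℕ} (hn : Computable n) (hL : Computable L)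
    (hX : Computable X) (hY : Computable Y) :
    Computable fun a => inclusion (n a) (L a) (X a) (Y a) :=
  Computable.comp (f := fun p : (ℕ × ℕ) × List ℕ × List ℕ => inclusion p.1.1 p.1.2 p.2.1 p.2.2)
    primrec_inclusion.to_comp ((hn.pair hL).pair (hX.pair hY))

/-- The code `pre` is itself an input, so this rests on the universality of `Code.eval`. -/
theorem partrec_preProgram (hL : Computable L) (hpre : Computable pre) (hX : Computable X)
    (hℓ : Computable ℓ) : Partrec fun a => preProgram (L a) (pre a) (X a) (ℓ a) := by
  refine Partrec.map (Partrec.tabulate ?_ hL) (primrec_disj.to_comp.comp Computable.snd).to₂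
  exact (Code.eval_part.comp (hpre.comp Computable.fst)
    (Primrec₂.natPair.to_comp.comp (hℓ.comp Computable.fst) (Primrec₂.natPair.to_comp.comp
      Computable.snd (primrec_entry.to_comp.comp (hX.comp Computable.fst) Computable.snd)))).to₂

theorem partrec_stageStep (hL : Computable L) (hpre : Computable pre) (hB : Computable B)
    (hZ : Computable Z) (hX : Computable X) :
    Partrec fun a => stageStep (L a) (pre a) (B a) (Z a) (X a) := by
  have hℓ : Computable fun p : (α × ℕ) × ℕ => p.1.2 := Computable.snd.comp Computable.fst
  have ha : Computable fun p : (α × ℕ) × ℕ => p.1.1 := Computable.fst.comp Computable.fst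
  have h : Computable fun p : (α × ℕ) × ℕ =>
      sup (entry (B p.1.1) p.1.2) (inf (entry (Z p.1.1) p.1.2) p.2) :=
    primrec_sup.to_comp.comp (primrec_entry.to_comp.comp (hB.comp ha) hℓ)
      (primrec_inf.to_comp.comp (primrec_entry.to_comp.comp (hZ.comp ha) hℓ) Computable.snd)
  have h' : Partrec fun p : α × ℕ => preProgram (L p.1) (pre p.1) (X p.1) p.2 :=
    partrec_preProgram (hL.comp Computable.fst) (hpre.comp Computable.fst)
      (hX.comp Computable.fst) Computable.snd
  exact Partrec.tabulate (f := fun a ℓ => (preProgram (L a) (pre a) (X a) ℓ).map fun x =>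
    sup (entry (B a) ℓ) (inf (entry (Z a) ℓ) x)) (h'.map h.to₂) hL

theorem partrec_stageProgram (hL : Computable L) (hpre : Computable pre) (hB : Computable B)
    (hZ : Computable Z) (hk : Computable k) :
    Partrec fun a => stageProgram (L a) (pre a) (B a) (Z a) (k a) := by
  have ha : Computable fun p : α × ℕ × List ℕ => p.1 := Computable.fst
  exact Partrec.nat_rec hk (Partrec.const' _) (partrec_stageStep (hL.comp ha) (hpre.comp ha)
    (hB.comp ha) (hZ.comp ha) (Computable.snd.comp Computable.snd)).to₂

/-- Only the decision procedure `f` is fixed; hence one algorithm serves all systems over the same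
structure. -/
theorem partrec_reachProgram {f : ℕ → Bool} (hf : Computable f) (hn : Computable n)
    (hL : Computable L) (hpre : Computable pre) (hB : Computable B) (hZ : Computable Z) :
    Partrec fun a => reachProgram f (n a) (L a) (pre a) (B a) (Z a) := by
  have ha : Computable fun p : α × ℕ => p.1 := Computable.fst
  have hb : Computable fun p : (α × ℕ) × List ℕ => p.1.1 := Computable.fst.comp Computable.fst
  have hc : Computable fun p : ((α × ℕ) × List ℕ) × List ℕ => p.1.1.1 := hb.comp Computable.fst
  have hstage : Partrec₂ fun (a : α) (k : ℕ) => stageProgram (L a) (pre a) (B a) (Z a) k :=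
    partrec_stageProgram (hL.comp ha) (hpre.comp ha) (hB.comp ha) (hZ.comp ha) Computable.snd
  have htest : Computable fun p : ((α × ℕ) × List ℕ) × List ℕ =>
      f (inclusion (n p.1.1.1) (L p.1.1.1) p.2 p.1.2) :=
    hf.comp (computable_inclusion (hn.comp hc) (hL.comp hc) Computable.snd
      (Computable.snd.comp Computable.fst))
  have hstep : Partrec fun p : (α × ℕ) × List ℕ =>
      stageStep (L p.1.1) (pre p.1.1) (B p.1.1) (Z p.1.1) p.2 :=
    partrec_stageStep (hL.comp hb) (hpre.comp hb) (hB.comp hb) (hZ.comp hb) Computable.snd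
  have hbody : Partrec₂ fun (a : α) (k : ℕ) =>
      (stageProgram (L a) (pre a) (B a) (Z a) k).bind fun X =>
        (stageStep (L a) (pre a) (B a) (Z a) X).map fun Y => f (inclusion (n a) (L a) Y X) :=
    Partrec.bind hstage (hstep.map htest.to₂).to₂
  exact (Partrec.rfind hbody).bind hstage

theorem partrec_nullProgram (hL : Computable L) (hpos : Computable pos) (hX : Computable X) :
    Partrec fun a => nullProgram (L a) (pos a) (X a) := by
  refine Partrec.map (Partrec.tabulate ?_ hL) ?_
  · exact (Code.eval_part.comp (hpos.comp Computable.fst) (Primrec₂.natPair.to_comp.comp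
      Computable.snd (primrec_entry.to_comp.comp (hX.comp Computable.fst) Computable.snd))).to₂
  · have h : Primrec fun l : List ℕ => l.foldr (· + ·) 0 :=
      Primrec.list_foldr Primrec.id (Primrec.const 0)
        (Primrec.nat_add.comp (Primrec.fst.comp Primrec.snd) (Primrec.snd.comp Primrec.snd)).to₂
    exact ((Primrec.eq.comp h (Primrec.const 0)).decide.to_comp.comp Computable.snd).to₂

end Computability

end Programs

/-! ### Correctness of the algorithms -/

namespace StochHybridSystem

open HybridSystem GodelNumber FirstOrder.Language
open Nat.Partrec (Code)

variable {n : ℕ} {H : StochHybridSystem n} {𝓛 : FirstOrder.Language.{u, v}}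
  [𝓛.Structure ℝ]

theorem mem_definedStates {φ : H.Loc → 𝓛.BoundedFormula Empty n} {s : H.State} :
    s ∈ H.definedStates φ ↔ (φ s.1).Realize Empty.elim s.2 := Iff.rfl

theorem measurableSet_definedSet {φ : H.Loc → 𝓛.BoundedFormula Empty n}
    (h : MeasurableSet (H.definedStates φ)) (ℓ : H.Loc) : MeasurableSet (φ ℓ).definedSet :=
  (measurable_prodMk_left (x := ℓ) h :)

theorem iUnion_locSet (φ : H.Loc → 𝓛.BoundedFormula Empty n) :
    ⋃ ℓ, H.locSet ℓ (φ ℓ).definedSet = H.definedStates φ := by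
  ext s
  simp [locSet, definedStates]

theorem realize_disj {k : ℕ} (ψ : Fin k → 𝓛.BoundedFormula Empty n) (v : Fin n → ℝ) :
    ((List.ofFn ψ).foldr (· ⊔ ·) ⊥).Realize Empty.elim v ↔
      ∃ i, (ψ i).Realize Empty.elim v := by
  simp [BoundedFormula.realize_foldr_sup]

variable [Encodable (Σ k, 𝓛.Functions k)] [Encodable (Σ k, 𝓛.Relations k)]

variable (𝓛) in
/-- The set `A` of states is defined by the formulas whose Gödel numbers are listed in `X`. -/
def Represents (X : List ℕ) (A : Set H.State) : Prop :=
  ∃ φ : H.Loc → 𝓛.BoundedFormula Empty n,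
    (∀ ℓ : H.Loc, entry X ℓ = (φ ℓ).godelNumber) ∧ H.definedStates φ = A

theorem entry_ofFn {k : ℕ} (g : Fin k → ℕ) (i : Fin k) : entry (List.ofFn g) i = g i := by
  simp [entry]

theorem represents_ofFn (φ : H.Loc → 𝓛.BoundedFormula Empty n) :
    Represents 𝓛 (List.ofFn fun ℓ => (φ ℓ).godelNumber) (H.definedStates φ) :=
  ⟨φ, entry_ofFn _, rfl⟩

theorem represents_nil : Represents 𝓛 [] (∅ : Set H.State) :=
  ⟨fun _ => ⊥, fun _ => rfl, Set.eq_empty_of_forall_notMem fun _ => id⟩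

theorem Represents.compl {X : List ℕ} {A : Set H.State} (h : Represents 𝓛 X A) :
    Represents 𝓛 (compl H.numLoc X) Aᶜ := by
  obtain ⟨φ, hX, rfl⟩ := h
  refine ⟨fun ℓ => (φ ℓ).not, fun ℓ => ?_, ?_⟩
  · rw [of_neg, ← hX]
    simp [entry, GodelNumber.compl]
  · ext s
    simp [mem_definedStates]

/-- `Pre` commutes with the union over target locations. Measurability of `A` is needed because
`pre` is only specified on measurable slices. -/
theorem exists_mem_preProgram {pre : Code} (hpre : H.ComputesPre 𝓛 pre) {X : List ℕ}
    {A : Set H.State} (hX : Represents 𝓛 X A) (hA : MeasurableSet A) (ℓ : H.Loc) :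
    ∃ ψ : 𝓛.BoundedFormula Empty n, ψ.godelNumber ∈ preProgram H.numLoc pre X ℓ ∧
      ∀ v, ψ.Realize Empty.elim v ↔ (ℓ, v) ∈ preSet H.step A := by
  obtain ⟨φ, hX, rfl⟩ := hX
  choose ψ hψ hψ' using fun ℓ' => hpre ℓ ℓ' (φ ℓ') (measurableSet_definedSet hA ℓ')
  refine ⟨(List.ofFn ψ).foldr (· ⊔ ·) ⊥, ?_, fun v => ?_⟩
  · rw [of_disj, List.map_ofFn]
    refine Part.mem_map _ (Part.ofFn_mem_tabulate fun ℓ' => ?_)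
    rw [hX, hψ]
    exact Part.mem_some _
  · rw [realize_disj, ← iUnion_locSet, preSet_iUnion, Set.mem_iUnion]
    exact exists_congr fun ℓ' => hψ' ℓ' v

theorem exists_mem_stageStep {pre : Code} (hpre : H.ComputesPre 𝓛 pre) {B Z X : List ℕ}
    {B' Z' A : Set H.State} (hB : Represents 𝓛 B B') (hZ : Represents 𝓛 Z Z')
    (hX : Represents 𝓛 X A) (hA : MeasurableSet A) :
    ∃ Y ∈ stageStep H.numLoc pre B Z X, Represents 𝓛 Y (B' ∪ Z' ∩ preSet H.step A) := by
  obtain ⟨β, hB, rfl⟩ := hB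
  obtain ⟨ζ, hZ, rfl⟩ := hZ
  choose ψ hψ hψ' using exists_mem_preProgram hpre hX hA
  refine ⟨List.ofFn fun ℓ => (β ℓ ⊔ (ζ ℓ ⊓ ψ ℓ)).godelNumber,
    Part.ofFn_mem_tabulate fun ℓ => ?_, fun ℓ => β ℓ ⊔ (ζ ℓ ⊓ ψ ℓ), entry_ofFn _, ?_⟩
  · rw [of_sup, of_inf, hB, hZ]
    exact Part.mem_map (fun a => sup _ (inf _ a)) (hψ ℓ)
  · ext s
    simp [mem_definedStates, hψ']

theorem exists_mem_stageProgram {pre : Code} (hpre : H.ComputesPre 𝓛 pre) {B Z : List ℕ}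
    {B' Z' : Set H.State} (hB : Represents 𝓛 B B') (hZ : Represents 𝓛 Z Z')
    (hBm : MeasurableSet B') (hZm : MeasurableSet Z') (k : ℕ) :
    ∃ Y ∈ stageProgram H.numLoc pre B Z k, Represents 𝓛 Y (reachStage H.step B' Z' k) := by
  induction k with
  | zero => exact ⟨[], Part.mem_some _, represents_nil⟩
  | succ k ih =>
    obtain ⟨X, hX, hXk⟩ := ih
    obtain ⟨Y, hY, hYk⟩ :=
      exists_mem_stageStep hpre hB hZ hXk (measurableSet_reachStage hBm hZm k)
    exact ⟨Y, Part.mem_bind hX hY, hYk⟩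

/-- The conjunction over locations is written as a negated disjunction of negations, under universal
quantifiers. -/
theorem decide_inclusion_iff {f : ℕ → Bool} (hf : ∀ φ : 𝓛.BoundedFormula Empty 0,
      f φ.godelNumber = true ↔ φ.Realize Empty.elim (![] : Fin 0 → ℝ))
    {X Y : List ℕ} {A A' : Set H.State} (hX : Represents 𝓛 X A) (hY : Represents 𝓛 Y A') :
    f (inclusion n H.numLoc X Y) = true ↔ A ⊆ A' := by
  obtain ⟨φ, hX, rfl⟩ := hX
  obtain ⟨ψ, hY, rfl⟩ := hY
  have h : inclusion n H.numLoc X Y = BoundedFormula.godelNumber (n := 0)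
      ((List.ofFn fun ℓ => ((φ ℓ).imp (ψ ℓ)).not).foldr (· ⊔ ·) ⊥).not.alls := by
    rw [of_alls, of_neg, of_disj, List.map_ofFn, inclusion]
    congr 3
    refine List.ext_getElem (by simp) fun i h1 h2 => ?_
    have hi : i < H.numLoc := by simpa using h1
    have hX' := hX ⟨i, hi⟩
    have hY' := hY ⟨i, hi⟩
    simp only [List.getElem_map, List.getElem_range, List.getElem_ofFn, Function.comp_apply,
      of_neg, of_imp, ← hX', ← hY']
  rw [h, hf]
  change FirstOrder.Language.Formula.Realize _ _ ↔ _
  rw [BoundedFormula.realize_alls]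
  simp only [BoundedFormula.realize_not, realize_disj, BoundedFormula.realize_imp]
  push Not
  exact ⟨fun h s => h s.2 s.1, fun h v ℓ => @h (ℓ, v)⟩

theorem exists_mem_reachProgram {f : ℕ → Bool} (hf : ∀ φ : 𝓛.BoundedFormula Empty 0,
      f φ.godelNumber = true ↔ φ.Realize Empty.elim (![] : Fin 0 → ℝ))
    (hH : H.CycleReset) {pre : Code} (hpre : H.ComputesPre 𝓛 pre) {B Z : List ℕ}
    {B' Z' : Set H.State} (hB : Represents 𝓛 B B') (hZ : Represents 𝓛 Z Z')
    (hBm : MeasurableSet B') (hZm : MeasurableSet Z') :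
    ∃ Y ∈ reachProgram f n H.numLoc pre B Z, Represents 𝓛 Y (reachSet H.step B' Z') := by
  have htest : ∀ k, ∃ b ∈ (stageProgram H.numLoc pre B Z k).bind fun X =>
      (stageStep H.numLoc pre B Z X).map fun Y => f (inclusion n H.numLoc Y X),
      (b = true ↔ reachStage H.step B' Z' (k + 1) ⊆ reachStage H.step B' Z' k) := by
    intro k
    obtain ⟨X, hX, hXk⟩ := exists_mem_stageProgram hpre hB hZ hBm hZm k
    obtain ⟨Y, hY, hYk⟩ :=
      exists_mem_stageStep hpre hB hZ hXk (measurableSet_reachStage hBm hZm k)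
    exact ⟨_, Part.mem_bind hX (Part.mem_map _ hY), decide_inclusion_iff hf hYk hXk⟩
  choose b hb hbk using htest
  obtain ⟨k, hk⟩ := hH.exists_reachStage_succ_subset hBm hZm
  have hdom : (Nat.rfind fun k => (stageProgram H.numLoc pre B Z k).bind fun X =>
      (stageStep H.numLoc pre B Z X).map fun Y => f (inclusion n H.numLoc Y X)).Dom :=
    -- The search also needs the test to halt at every earlier stage, as it does.
    Nat.rfind_dom.2 ⟨k, (hbk k).2 hk ▸ hb k, fun {m} _ => Part.dom_iff_mem.2 ⟨_, hb m⟩⟩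
  obtain ⟨m, hm⟩ := Part.dom_iff_mem.1 hdom
  -- The index `m` found may differ from `k`; passing the test suffices.
  have hk' := (hbk m).1 (Part.mem_unique (hb m) (Nat.rfind_spec hm))
  obtain ⟨Y, hY, hYm⟩ := exists_mem_stageProgram hpre hB hZ hBm hZm m
  exact ⟨Y, Part.mem_bind hm hY, reachSet_eq_of_stage_succ_subset hk' ▸ hYm⟩

/-- A finite union is null iff every slice is, that is, iff the outputs in `{0, 1}` sum to `0`. -/
theorem exists_mem_nullProgram {μ : Measure H.State} {pos : Code}
    (hpos : H.DecidesPositivity 𝓛 μ pos) {X : List ℕ} {A : Set H.State}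
    (hX : Represents 𝓛 X A) (hA : MeasurableSet A) :
    ∃ b ∈ nullProgram H.numLoc pos X, (b = true ↔ μ A = 0) := by
  obtain ⟨φ, hX, rfl⟩ := hX
  choose b hb hb' using fun ℓ => hpos ℓ (φ ℓ) (measurableSet_definedSet hA ℓ)
  refine ⟨_, Part.mem_map _ (Part.ofFn_mem_tabulate (g := fun ℓ => (b ℓ).toNat) fun ℓ => ?_), ?_⟩
  · rw [hX, hb]
    exact Part.mem_some _
  · rw [decide_eq_true_iff, ← iUnion_locSet, measure_iUnion_null_iff, ← List.sum_eq_foldr,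
      List.sum_ofFn, Finset.sum_eq_zero_iff]
    refine ⟨fun h ℓ => ?_, fun h ℓ _ => ?_⟩
    · by_contra h0
      have h1 := h ℓ (Finset.mem_univ ℓ)
      rw [(hb' ℓ).2 (pos_iff_ne_zero.2 h0)] at h1
      exact absurd h1 one_ne_zero
    · rw [Bool.toNat_eq_zero, ← Bool.not_eq_true, hb', h ℓ]
      exact lt_irrefl _

end StochHybridSystem

open GodelNumber in
theorem mainTheorem5 {𝓛 : FirstOrder.Language.{u, v}} [Encodable (Σ k, 𝓛.Functions k)]
    [Encodable (Σ k, 𝓛.Relations k)] [𝓛.Structure ℝ]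
    (lt : 𝓛.Relations 2)
    (_hlt : ∀ x y : ℝ, FirstOrder.Language.Structure.RelMap lt ![x, y] ↔ x < y)
    (_hdec : TheoryOfRealDecidable 𝓛) :
    ∃ almostSure null :
        ℕ × ℕ × Nat.Partrec.Code × Nat.Partrec.Code × List ℕ →. Bool,
      Partrec almostSure ∧ Partrec null ∧
      ∀ (n : ℕ) (H : StochHybridSystem n), H.DefinedIn 𝓛 → H.CycleReset →
      ∀ pre : Nat.Partrec.Code, H.ComputesPre 𝓛 pre →
      ∀ (μ : Measure H.State) [IsProbabilityMeasure μ] (pos : Nat.Partrec.Code),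
        H.DecidesPositivity 𝓛 μ pos →
      ∀ φ : H.Loc → 𝓛.BoundedFormula Empty n, MeasurableSet (H.definedStates φ) →
        (∃ b ∈ almostSure
            (n, H.numLoc, pre, pos, List.ofFn fun ℓ => (φ ℓ).godelNumber),
          (b = true ↔ H.reachProb μ (H.definedStates φ) = 1)) ∧
        (∃ b ∈ null
            (n, H.numLoc, pre, pos, List.ofFn fun ℓ => (φ ℓ).godelNumber),
          (b = true ↔ H.reachProb μ (H.definedStates φ) = 0)) := by
  obtain ⟨f, hf, hf'⟩ := _hdec
  -- `possible` computes `C`, and `avoiding` computes `D` from `C`.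
  let possible : ℕ × ℕ × Nat.Partrec.Code × Nat.Partrec.Code × List ℕ →. List ℕ := fun a =>
    reachProgram f a.1 a.2.1 a.2.2.1 a.2.2.2.2 (compl a.2.1 a.2.2.2.2)
  let avoiding : ℕ × ℕ × Nat.Partrec.Code × Nat.Partrec.Code × List ℕ → List ℕ →. List ℕ :=
    fun a C => reachProgram f a.1 a.2.1 a.2.2.1 (compl a.2.1 C) (compl a.2.1 a.2.2.2.2)
  have hL : Computable fun a : ℕ × ℕ × Nat.Partrec.Code × Nat.Partrec.Code × List ℕ => a.2.1 :=
    Computable.fst.comp Computable.snd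
  have hpre : Computable fun a : ℕ × ℕ × Nat.Partrec.Code × Nat.Partrec.Code × List ℕ =>
      a.2.2.1 := Computable.fst.comp (Computable.snd.comp Computable.snd)
  have hpos : Computable fun a : ℕ × ℕ × Nat.Partrec.Code × Nat.Partrec.Code × List ℕ =>
      a.2.2.2.1 :=
    Computable.fst.comp (Computable.snd.comp (Computable.snd.comp Computable.snd))
  have hB : Computable fun a : ℕ × ℕ × Nat.Partrec.Code × Nat.Partrec.Code × List ℕ =>
      a.2.2.2.2 :=
    Computable.snd.comp (Computable.snd.comp (Computable.snd.comp Computable.snd))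
  have hZ : Computable fun a : ℕ × ℕ × Nat.Partrec.Code × Nat.Partrec.Code × List ℕ =>
      compl a.2.1 a.2.2.2.2 := primrec_compl.to_comp.comp hL hB
  have hpossible : Partrec possible := partrec_reachProgram hf Computable.fst hL hpre hB hZ
  have havoiding : Partrec₂ avoiding :=
    partrec_reachProgram hf (Computable.fst.comp Computable.fst) (hL.comp Computable.fst)
      (hpre.comp Computable.fst)
      (primrec_compl.to_comp.comp (hL.comp Computable.fst) Computable.snd)
      (hZ.comp Computable.fst)
  have hnull : Partrec₂ fun (a : ℕ × ℕ × Nat.Partrec.Code × Nat.Partrec.Code × List ℕ)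
      (X : List ℕ) => nullProgram a.2.1 a.2.2.2.1 X :=
    partrec_nullProgram (hL.comp Computable.fst) (hpos.comp Computable.fst) Computable.snd
  refine ⟨fun a => ((possible a).bind (avoiding a)).bind (nullProgram a.2.1 a.2.2.2.1),
    fun a => (possible a).bind (nullProgram a.2.1 a.2.2.2.1),
    (hpossible.bind havoiding).bind hnull, hpossible.bind hnull, ?_⟩
  intro n H _ hH pre hpre μ _ pos hpos φ hφ
  have hB := StochHybridSystem.represents_ofFn φ
  obtain ⟨C, hC, hC'⟩ := StochHybridSystem.exists_mem_reachProgram hf' hH hpre hB hB.compl hφ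
    hφ.compl
  have hCm : MeasurableSet (reachSet H.step (H.definedStates φ) (H.definedStates φ)ᶜ) :=
    MeasurableSet.iUnion fun k => measurableSet_reachStage hφ hφ.compl k
  obtain ⟨D, hD, hD'⟩ := StochHybridSystem.exists_mem_reachProgram hf' hH hpre hC'.compl hB.compl
    hCm.compl hφ.compl
  have hDm := MeasurableSet.iUnion fun k =>
    measurableSet_reachStage (κ := H.step) hCm.compl hφ.compl k
  obtain ⟨b₀, hb₀, hb₀'⟩ := StochHybridSystem.exists_mem_nullProgram hpos hC' hCm
  obtain ⟨b₁, hb₁, hb₁'⟩ := StochHybridSystem.exists_mem_nullProgram hpos hD' hDm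
  exact ⟨⟨b₁, Part.mem_bind (Part.mem_bind hC hD) hb₁,
      hb₁'.trans (runMeasure_eventually_eq_one_iff_reachSet hφ (hH.decisive hφ)).symm⟩,
    ⟨b₀, Part.mem_bind hC hb₀, hb₀'.trans (runMeasure_eventually_eq_zero_iff_reachSet hφ).symm⟩⟩
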